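/- Throughout, graphs are simple and $V(G)=\{1,\dots,n\}$. The degeneracy $\kappa=\kappa(G)$ is the least $k$ such that every non-empty induced subgraph of $G$ has a vertex of degree at most $k$ in that subgraph. An edge stream of $G$ lists the edges of $G$, each exactly once, in arbitrary order. A randomized one-pass streaming algorithm with $s$ bits of space, for $n$-vertex graphs, is a probability distribution on deterministic algorithms that keep a memory in $\{0,1\}^s$, update it upon each arriving edge (as a function of the memory and the edge), and produce their output from the final memory content; the random string is not charged as space. It performs a task if, for every $n$-vertex graph $G$ and every edge stream of $G$, its output is correct with probability at least $2/3$. For $\lambda\ge 1$ an integer, consider the tasks (i) produce a proper colouring of $G$ with at most $\kappa+\lambda$ colours; (ii) produce a real number $\hat\kappa$ with $|\hat\kappa-\kappa|\le\lambda$. Neither $\kappa$ nor any other information about $G$ except $n$ is given in advance. **Theorem.** (a) Each of the tasks (i), (ii) requires $\Omega(n^2/\lambda^2)$ bits of space: there are absolute constants $c>0$ and $C$ such that for all integers $\lambda\ge 1$ and $n\ge C\lambda$, every randomized one-pass streaming algorithm that performs task (i), or task (ii), for $n$-vertex graphs uses at least $c\,n^2/\lambda^2$ bits of space. (b) Let $\gamma>0$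 and let $\lambda=\lambda(\kappa)\ge 1$ be an integer-valued function of $\kappa$ with $\lambda(\kappa)=O(\kappa^{1/2-\gamma})$ as $\kappa\to\infty$. Then neither task, with $\lambda=\lambda(\kappa(G))$, admits a semi-streaming algorithm: if $s(n)=O(n(\log n)^k)$ for some $k$, then for all sufficiently large $n$ no randomized one-pass streaming algorithm with $s(n)$ bits of space performs task (i) for $n$-vertex graphs, and none performs task (ii). -/

import Mathlib

open Filter Asymptotics

/-- `G` is `k`-degenerate: every induced subgraph (on a nonempty vertex set `S`) has a vertex
whose degree in that induced subgraph is at most `k`. -/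
def IsDegenerate {V : Type*} [Finite V] (G : SimpleGraph V) (k : ℕ) : Prop :=
  ∀ S : Set V, S.Nonempty → ∃ v ∈ S, {u ∈ S | G.Adj v u}.ncard ≤ k

/-- The degeneracy `κ(G)`: the smallest `k` such that `G` is `k`-degenerate. -/
noncomputable def degeneracy {V : Type*} [Finite V] (G : SimpleGraph V) : ℕ :=
  sInf {k | IsDegenerate G k}

/-- `col` is a proper colouring of `G` using at most `c` colours. The names of the colours are
irrelevant, only their number counts; in particular every proper map into `{1, …, c}` qualifies. -/
def IsProperColoring {n : ℕ} (G : SimpleGraph (Fin n)) (c : ℕ) (col : Fin n → ℕ) : Prop :=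
  (∀ u v, G.Adj u v → col u ≠ col v) ∧ (Finset.univ.image col).card ≤ c

/-- The edge stream `σ` builds up `G` in the insertion-only model: it lists every edge of `G`
exactly once, in some order. -/
def IsEdgeStream {n : ℕ} (G : SimpleGraph (Fin n)) (σ : List (Sym2 (Fin n))) : Prop :=
  σ.Nodup ∧ ∀ e, e ∈ σ ↔ e ∈ G.edgeSet

/-- A deterministic one-pass streaming algorithm with `s` bits of memory for edge streams on the
vertex set `Fin n`: an initial memory content, an update for each arriving edge, and an output
read off from the final memory content. -/
structure StreamAlg (n s : ℕ) (Out : Type) where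
  init : Fin s → Bool
  step : (Fin s → Bool) → Sym2 (Fin n) → (Fin s → Bool)
  out : (Fin s → Bool) → Out

/-- The output of the algorithm after one pass over the stream `σ`. -/
def StreamAlg.run {n s : ℕ} {Out : Type} (D : StreamAlg n s Out) (σ : List (Sym2 (Fin n))) : Out :=
  D.out (σ.foldl D.step D.init)

/-- A randomized one-pass streaming algorithm with `s` bits of memory: a probability distribution
on deterministic ones, that is, the random string is not charged as space. As no edge occurs twice
in a stream, this also covers algorithms that toss fresh coins at every update (the coins for the
arrival of the edge `e` are a separate part of the random string). -/
abbrev RandStreamAlg (n s : ℕ) (Out : Type) := PMF (StreamAlg n s Out)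

/-- `A` performs the task "output some `o` with `Good G o`" with success probability at least
`2/3`: for every input graph `G` on `n` vertices and every ordering of its edge stream. -/
def RandStreamAlg.Solves {n s : ℕ} {Out : Type} (A : RandStreamAlg n s Out)
    (Good : SimpleGraph (Fin n) → Out → Prop) : Prop :=
  ∀ (G : SimpleGraph (Fin n)) (σ : List (Sym2 (Fin n))), IsEdgeStream G σ →
    2 / 3 ≤ A.toOuterMeasure {D | Good G (D.run σ)}

/-- Some randomized one-pass algorithm with `s` bits of memory produces, with probability at least
`2/3`, a proper `(κ + λ)`-colouring of every `n`-vertex input graph, where `κ` is the degeneracy of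
the graph; the number `λ = lam κ` is allowed to depend on `κ`. -/
def ColoringInSpace (n s : ℕ) (lam : ℕ → ℕ) : Prop :=
  ∃ A : RandStreamAlg n s (Fin n → ℕ),
    RandStreamAlg.Solves A fun G col => IsProperColoring G (degeneracy G + lam (degeneracy G)) col

/-- Some randomized one-pass algorithm with `s` bits of memory produces, with probability at least
`2/3`, an estimate of the degeneracy `κ` of every `n`-vertex input graph that is within `± λ`; the
number `λ = lam κ` is allowed to depend on `κ`. -/
def EstimationInSpace (n s : ℕ) (lam : ℕ → ℕ) : Prop :=
  ∃ A : RandStreamAlg n s ℝ,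
    RandStreamAlg.Solves A fun G est => |est - (degeneracy G : ℝ)| ≤ (lam (degeneracy G) : ℝ)

/-- The space bound of a semi-streaming algorithm: `Õ(n)` bits, that is, `O(n (log n) ^ k)` bits
for some `k`. -/
def IsSemiStreaming (s : ℕ → ℕ) : Prop :=
  ∃ k : ℕ, (fun n => (s n : ℝ)) =O[atTop] fun n => (n : ℝ) * Real.log n ^ k

/-! The proof is a reduction from the index problem in one-way communication. Alice holds `p ^ 2`
bits and streams a bipartite graph between `p` left and `p` right blocks of size `b`, where bit `(i,
j)` joins block `i` completely to block `j`. Bob, who wants one bit, adds all edges on his two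
blocks and a hub of size `q ≥ p * b`, except those between the two blocks. If the bit is 1, this
core is a clique on `q + 2 * b` vertices and the degeneracy is `q + 2 * b - 1`; if it is 0, the
degeneracy is only `q + b - 1`. The hub makes the vertices outside the core irrelevant: their degree
is at most `p * b ≤ q`.

An estimate with error below `b / 2` separates the two values. So does a colouring: for bit 1 the
two blocks share no colour, while for bit 0 and slack at most `b` there are fewer colours than core
vertices, so two core vertices agree, and they must lie in different blocks (`coloring_decodes`).
The memory after Alice's edges thus encodes her bits, whence `p ^ 2 ≤ 15 * s` (`card_le_of_solves`).
Taking `b` of the order of the slack and `p` of order `n / b` gives both parts. -/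

/-! ### Index problem: averaging and counting. -/

/-- Averaging: if every event `E a` of a finite family has probability at least `2/3`, then some
outcome lies in at least two thirds of the events. -/
lemma exists_two_thirds_of_forall_prob {Ω α : Type*} [Fintype α] (A : PMF Ω) (E : α → Set Ω)
    [∀ ω, DecidablePred fun a => ω ∈ E a]
    (h : ∀ a, 2 / 3 ≤ A.toOuterMeasure (E a)) :
    ∃ ω, 2 * Fintype.card α ≤ 3 * (Finset.univ.filter fun a => ω ∈ E a).card := by
  by_contra! hc
  have h1 : (2 / 3 : ENNReal) * Fintype.card α ≤
      ∑' ω, A ω * ((Finset.univ.filter fun a => ω ∈ E a).card : ENNReal) := by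
    calc (2 / 3 : ENNReal) * Fintype.card α = ∑ _a : α, (2 / 3 : ENNReal) := by
          simp [mul_comm]
      _ ≤ ∑ a, A.toOuterMeasure (E a) := Finset.sum_le_sum fun a _ => h a
      _ = ∑ a, ∑' ω, (E a).indicator A ω := by simp_rw [PMF.toOuterMeasure_apply]
      _ = ∑' ω, ∑ a, (E a).indicator A ω := by
          rw [← tsum_fintype (L := .unconditional _), ENNReal.tsum_comm]; simp_rw [tsum_fintype]
      _ = _ := by
          refine tsum_congr fun ω => ?_
          simp only [Set.indicator_apply]
          rw [← Finset.sum_filter, Finset.sum_const, nsmul_eq_mul, mul_comm]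
  -- The strict inequality between integers becomes a gain of 1 at every outcome, which survives
  -- summation because the masses sum to 1.
  have h2 : ∑' ω, A ω * (3 * ((Finset.univ.filter fun a => ω ∈ E a).card : ENNReal) + 1) ≤
      2 * (Fintype.card α : ENNReal) := by
    calc _ ≤ ∑' ω, A ω * (2 * (Fintype.card α : ENNReal)) := by
          refine ENNReal.tsum_le_tsum fun ω => mul_le_mul_right ?_ _
          exact_mod_cast hc ω
      _ = _ := by rw [ENNReal.tsum_mul_right, A.tsum_coe, one_mul]
  have h3 : ∑' ω, A ω * (3 * ((Finset.univ.filter fun a => ω ∈ E a).card : ENNReal) + 1) =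
      3 * (∑' ω, A ω * ((Finset.univ.filter fun a => ω ∈ E a).card : ENNReal)) + 1 := by
    rw [← ENNReal.tsum_mul_left]
    conv_rhs => rw [← A.tsum_coe, ← ENNReal.tsum_add]
    exact tsum_congr fun ω => by ring
  have h4 : 2 * (Fintype.card α : ENNReal) ≤
      3 * (∑' ω, A ω * ((Finset.univ.filter fun a => ω ∈ E a).card : ENNReal)) := by
    calc 2 * (Fintype.card α : ENNReal) = 3 * ((2 / 3 : ENNReal) * Fintype.card α) := by
          rw [← mul_assoc, ENNReal.mul_div_cancel (by norm_num) (by norm_num)]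
      _ ≤ _ := by gcongr
  rw [h3] at h2
  have h5 : 2 * (Fintype.card α : ENNReal) + 1 ≤ 2 * (Fintype.card α : ENNReal) :=
    (add_le_add_left h4 1).trans h2
  have h6 : 2 * Fintype.card α + 1 ≤ 2 * Fintype.card α := by exact_mod_cast h5
  omega

/-- The generating function of the Hamming distance to a fixed vector, at `1/2`. -/
lemma sum_half_pow_hammingDist {ι : Type*} [Fintype ι] [DecidableEq ι] (y : ι → Bool) :
    ∑ x : ι → Bool, (1 / 2 : ℝ) ^ hammingDist x y = (3 / 2) ^ Fintype.card ι := by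
  have h : ∀ x : ι → Bool, (1 / 2 : ℝ) ^ hammingDist x y =
      ∏ i, if x i ≠ y i then (1 / 2 : ℝ) else 1 := by
    intro x
    rw [hammingDist, Finset.prod_ite, Finset.prod_const, Finset.prod_const_one, mul_one]
  simp_rw [h]
  have := Finset.prod_univ_sum (fun _ : ι => (Finset.univ : Finset Bool))
    (fun i c => if c ≠ y i then (1 / 2 : ℝ) else 1)
  rw [Fintype.piFinset_univ] at this
  rw [← this]
  have h2 : ∀ i, (∑ c : Bool, if c ≠ y i then (1 / 2 : ℝ) else 1) = 3 / 2 := by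
    intro i
    rw [Fintype.sum_bool]
    cases y i <;> norm_num
  rw [Finset.prod_congr rfl fun i _ => h2 i, Finset.prod_const, Finset.card_univ]

/-- If every Boolean vector `x` is assigned one of at most `2 ^ s` vectors at distance from `x` that
is on average at most a third of the length, then the length is at most `15 * s`. -/
lemma card_le_of_sum_hammingDist_le {ι : Type*} [Fintype ι] [DecidableEq ι] {s : ℕ}
    (m : (ι → Bool) → (Fin s → Bool)) (y : (Fin s → Bool) → ι → Bool)
    (h : 3 * ∑ x, hammingDist x (y (m x)) ≤ 2 ^ Fintype.card ι * Fintype.card ι) :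
    Fintype.card ι ≤ 15 * s := by
  set N := Fintype.card ι with hN
  have hl : 0 < Real.log 2 := Real.log_pos (by norm_num)
  have hup : ∑ x : ι → Bool, (1 / 2 : ℝ) ^ hammingDist x (y (m x)) ≤ 2 ^ s * (3 / 2) ^ N := by
    calc _ ≤ ∑ x : ι → Bool, ∑ μ, (1 / 2 : ℝ) ^ hammingDist x (y μ) := by
          refine Finset.sum_le_sum fun x _ => ?_
          exact Finset.single_le_sum (f := fun μ => (1 / 2 : ℝ) ^ hammingDist x (y μ))
            (fun μ _ => by positivity) (Finset.mem_univ (m x))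
      _ = _ := by
          rw [Finset.sum_comm]
          simp_rw [sum_half_pow_hammingDist]
          simp [← hN]
  have hlow : (2 : ℝ) ^ N * Real.exp (-(N * Real.log 2 / 3)) ≤
      ∑ x : ι → Bool, (1 / 2 : ℝ) ^ hammingDist x (y (m x)) := by
    -- Jensen's inequality, in the form of the tangent to the exponential at distance `N / 3`.
    have hpt : ∀ x : ι → Bool, Real.exp (-(N * Real.log 2 / 3)) *
        (1 + N * Real.log 2 / 3 - Real.log 2 * (hammingDist x (y (m x)) : ℝ)) ≤
        (1 / 2 : ℝ) ^ hammingDist x (y (m x)) := by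
      intro x
      have h1 : (1 / 2 : ℝ) ^ hammingDist x (y (m x)) =
          Real.exp (-(N * Real.log 2 / 3)) * Real.exp
            (N * Real.log 2 / 3 - Real.log 2 * (hammingDist x (y (m x)) : ℝ)) := by
        rw [← Real.exp_add, ← Real.exp_log (show (0 : ℝ) < (1 / 2) ^ _ by positivity),
          Real.log_pow, one_div, Real.log_inv]
        congr 1; ring
      rw [h1]
      refine mul_le_mul_of_nonneg_left ?_ (Real.exp_pos _).le
      have := Real.add_one_le_exp
        (N * Real.log 2 / 3 - Real.log 2 * (hammingDist x (y (m x)) : ℝ))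
      linarith
    refine le_trans ?_ (Finset.sum_le_sum fun x _ => hpt x)
    rw [← Finset.mul_sum, mul_comm, Finset.sum_sub_distrib, ← Finset.mul_sum, Finset.sum_const]
    refine mul_le_mul_of_nonneg_left ?_ (Real.exp_pos _).le
    have hcard : (Finset.univ : Finset (ι → Bool)).card = 2 ^ N := by simp [← hN]
    rw [hcard, nsmul_eq_mul]
    push_cast
    have h' : (3 : ℝ) * ∑ x, (hammingDist x (y (m x)) : ℝ) ≤ 2 ^ N * N := by exact_mod_cast h
    nlinarith
  have hlog := Real.log_le_log (by positivity) (hlow.trans hup)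
  rw [Real.log_mul (by positivity) (by positivity), Real.log_mul (by positivity) (by positivity),
    Real.log_exp, Real.log_pow, Real.log_pow, Real.log_pow,
    Real.log_div (by norm_num) (by norm_num)] at hlog
  -- This bounds `log (3 / 2)` by `3 / 5 * log 2`; the constant 15 comes from `1 - 1 / 3 - 3 / 5 = 1
  -- / 15`.
  have h3 : 5 * Real.log 3 ≤ 8 * Real.log 2 := by
    have := Real.log_le_log (by norm_num) (show (3 : ℝ) ^ 5 ≤ 2 ^ 8 by norm_num)
    rw [Real.log_pow, Real.log_pow] at this
    exact_mod_cast this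
  have hN0 : (0 : ℝ) ≤ N := by positivity
  have h4 := mul_le_mul_of_nonneg_left h3 hN0
  have h5 : (N : ℝ) * Real.log 2 ≤ (15 * s) * Real.log 2 := by linarith
  exact_mod_cast le_of_mul_le_mul_right h5 hl

/-- The one-way communication lower bound for the index problem, for streaming algorithms: if the
bit `x i` can be read off from every good output on the stream `alice x ++ bob i`, then the space is
at least linear in the number of bits. -/
lemma card_le_of_solves {n s : ℕ} {Out ι : Type} [Fintype ι] {A : RandStreamAlg n s Out}
    {Good : SimpleGraph (Fin n) → Out → Prop} (hA : A.Solves Good)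
    (G : (ι → Bool) → ι → SimpleGraph (Fin n))
    (alice : (ι → Bool) → List (Sym2 (Fin n))) (bob : ι → List (Sym2 (Fin n)))
    (hstream : ∀ x i, IsEdgeStream (G x i) (alice x ++ bob i)) (dec : ι → Out → Bool)
    (hdec : ∀ x i o, Good (G x i) o → dec i o = x i) :
    Fintype.card ι ≤ 15 * s := by
  classical
  -- Fix the coins so that at least two thirds of all pairs (bits, index) are decoded correctly.
  obtain ⟨D, hD⟩ := exists_two_thirds_of_forall_prob A
    (fun a : (ι → Bool) × ι => {D | dec a.2 (D.run (alice a.1 ++ bob a.2)) = a.1 a.2})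
    (fun a => (hA _ _ (hstream a.1 a.2)).trans
      (MeasureTheory.measure_mono fun D hD => hdec _ _ _ hD))
  refine card_le_of_sum_hammingDist_le (fun x => (alice x).foldl D.step D.init)
    (fun μ i => dec i (D.out ((bob i).foldl D.step μ))) ?_
  have hcount : (∑ x : ι → Bool, hammingDist x
        (fun i => dec i (D.out ((bob i).foldl D.step ((alice x).foldl D.step D.init))))) +
      (Finset.univ.filter fun a : (ι → Bool) × ι =>
        dec a.2 (D.run (alice a.1 ++ bob a.2)) = a.1 a.2).card =
      Fintype.card ((ι → Bool) × ι) := by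
    have h1 : (∑ x : ι → Bool, hammingDist x
        (fun i => dec i (D.out ((bob i).foldl D.step ((alice x).foldl D.step D.init))))) =
        (Finset.univ.filter fun a : (ι → Bool) × ι =>
          ¬ dec a.2 (D.run (alice a.1 ++ bob a.2)) = a.1 a.2).card := by
      simp only [hammingDist, Finset.card_filter, Fintype.sum_prod_type, StreamAlg.run,
        List.foldl_append, ne_eq, eq_comm]
    rw [h1, add_comm, Finset.card_filter_add_card_filter_not, Finset.card_univ]
  simp only [Set.mem_ofPred_eq] at hD
  rw [Fintype.card_prod, Fintype.card_fun, Fintype.card_bool] at hcount hD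
  omega

/-! ### Degeneracy: isomorphism invariance and clique bounds. -/

lemma IsDegenerate.of_iso {V W : Type*} [Finite V] [Finite W] {G : SimpleGraph V}
    {H : SimpleGraph W} (φ : G ≃g H) {k : ℕ} (h : IsDegenerate G k) : IsDegenerate H k := by
  intro S hS
  obtain ⟨w, hw⟩ := hS
  obtain ⟨v, hv, hk⟩ := h (φ ⁻¹' S) ⟨φ.symm w, by simpa using hw⟩
  refine ⟨φ v, hv, le_of_eq_of_le ?_ hk⟩
  rw [← Set.ncard_image_of_injective _ φ.injective]
  congr 1
  ext u
  constructor
  · rintro ⟨hu, huv⟩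
    refine ⟨φ.symm u, ⟨by simpa using hu, ?_⟩, by simp⟩
    rw [← φ.map_adj_iff]
    simpa using huv
  · rintro ⟨u, ⟨hu, huv⟩, rfl⟩
    exact ⟨hu, φ.map_adj_iff.2 huv⟩

lemma degeneracy_congr {V W : Type*} [Finite V] [Finite W] {G : SimpleGraph V}
    {H : SimpleGraph W} (φ : G ≃g H) : degeneracy G = degeneracy H := by
  unfold degeneracy
  congr 1
  ext k
  exact ⟨.of_iso φ, .of_iso φ.symm⟩

/-- A clique on `k + 1` vertices forces degeneracy at least `k`. -/
lemma IsDegenerate.card_clique_le {V : Type*} [Finite V] {G : SimpleGraph V} {k : ℕ}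
    (h : IsDegenerate G k) {K : Finset V} (hK : G.IsClique (K : Set V)) : K.card ≤ k + 1 := by
  classical
  rcases K.eq_empty_or_nonempty with rfl | hne
  · simp
  obtain ⟨v, hv, hk⟩ := h K hne
  have hset : {u ∈ (K : Set V) | G.Adj v u} = ((K.erase v : Finset V) : Set V) := by
    ext u
    simp only [Finset.mem_coe, Set.mem_ofPred_eq, Finset.mem_erase]
    exact ⟨fun ⟨hu, huv⟩ => ⟨huv.ne', hu⟩, fun ⟨hne, hu⟩ => ⟨hu, hK hv hu hne.symm⟩⟩
  rw [hset, Set.ncard_coe_finset, Finset.card_erase_of_mem hv] at hk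
  omega

lemma degeneracy_eq {V : Type*} [Finite V] {G : SimpleGraph V} {k : ℕ} (h : IsDegenerate G k)
    {K : Finset V} (hK : G.IsClique (K : Set V)) (hcard : k + 1 ≤ K.card) : degeneracy G = k := by
  refine le_antisymm (Nat.sInf_le h) (le_csInf ⟨k, h⟩ fun j hj => ?_)
  have := IsDegenerate.card_clique_le hj hK
  omega

lemma ncard_le_of_subset_finset {V : Type*} {A : Set V} {B : Finset V} (h : A ⊆ B) {k : ℕ}
    (hB : B.card ≤ k) : A.ncard ≤ k :=
  (Set.ncard_le_ncard h B.finite_toSet).trans (by rwa [Set.ncard_coe_finset])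

/-- Used for neighbourhoods: since `v` is not its own neighbour, its degree inside `B` is one less
than the size of `B`. -/
lemma ncard_lt_of_subset_erase {V : Type*} [DecidableEq V] {A : Set V} {B : Finset V} {v : V}
    (hv : v ∈ B) (h : A ⊆ (B.erase v : Finset V)) {k : ℕ} (hB : B.card ≤ k + 1) : A.ncard ≤ k :=
  ncard_le_of_subset_finset h (by rw [Finset.card_erase_of_mem hv]; omega)

/-! ### The gadget graph and its degeneracy. -/

namespace IndexGadget

/-- The vertices of the gadget: `p` left blocks and `p` right blocks of size `b`, and a hub of
size `q`. -/
abbrev Vert (p b q : ℕ) := (Fin p × Fin b) ⊕ ((Fin p × Fin b) ⊕ Fin q)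

variable {p b q : ℕ}

/-- The `i`-th left block. -/
def left (i : Fin p) : Finset (Vert p b q) := Finset.univ.image fun t => Sum.inl (i, t)

/-- The `j`-th right block. -/
def right (j : Fin p) : Finset (Vert p b q) := Finset.univ.image fun t => Sum.inr (Sum.inl (j, t))

/-- The hub. -/
def hub : Finset (Vert p b q) := Finset.univ.image fun t => Sum.inr (Sum.inr t)

lemma card_left (i : Fin p) : (left i : Finset (Vert p b q)).card = b := by
  rw [left, Finset.card_image_of_injective _ fun _ _ h => by simpa using h]; simp

lemma card_right (j : Fin p) : (right j : Finset (Vert p b q)).card = b := by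
  rw [right, Finset.card_image_of_injective _ fun _ _ h => by simpa using h]; simp

lemma card_hub : (hub : Finset (Vert p b q)).card = q := by
  rw [hub, Finset.card_image_of_injective _ fun _ _ h => by simpa using h]; simp

lemma disjoint_left_right (i j : Fin p) : Disjoint (left i : Finset (Vert p b q)) (right j) := by
  rw [Finset.disjoint_left]; simp [left, right]

lemma disjoint_left_hub (i : Fin p) : Disjoint (left i : Finset (Vert p b q)) hub := by
  rw [Finset.disjoint_left]; simp [left, hub]

lemma disjoint_right_hub (j : Fin p) : Disjoint (right j : Finset (Vert p b q)) hub := by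
  rw [Finset.disjoint_left]; simp [right, hub]

/-- The two blocks selected by `(i, j)`, together with the hub. -/
def core (ij : Fin p × Fin p) : Finset (Vert p b q) := left ij.1 ∪ (right ij.2 ∪ hub)

lemma card_core (ij : Fin p × Fin p) : (core ij : Finset (Vert p b q)).card = 2 * b + q := by
  rw [core, Finset.card_union_of_disjoint, Finset.card_union_of_disjoint (disjoint_right_hub _),
    card_left, card_right, card_hub]
  · ring
  · rw [Finset.disjoint_union_right]
    exact ⟨disjoint_left_right _ _, disjoint_left_hub _⟩

/-- The graph encoding the bits `x`: the `i`-th left and the `j`-th right block are completely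
joined if `x (i, j)` is set. -/
def bitGraph (x : Fin p × Fin p → Bool) : SimpleGraph (Vert p b q) where
  Adj u v := ∃ i j, x (i, j) = true ∧ (u ∈ left i ∧ v ∈ right j ∨ v ∈ left i ∧ u ∈ right j)
  symm := ⟨fun _ _ ⟨i, j, hx, h⟩ => ⟨i, j, hx, h.symm⟩⟩
  loopless := ⟨fun _ ⟨i, j, _, h⟩ => by
    rcases h with h | h <;> exact Finset.disjoint_left.1 (disjoint_left_right i j) h.1 h.2⟩

/-- The graph querying the bit `(i, j)`: all pairs of vertices of the core, except for those that
join its two blocks. -/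
def queryGraph (ij : Fin p × Fin p) : SimpleGraph (Vert p b q) where
  Adj u v := u ≠ v ∧ u ∈ core ij ∧ v ∈ core ij ∧
    ¬ (u ∈ left ij.1 ∧ v ∈ right ij.2) ∧ ¬ (v ∈ left ij.1 ∧ u ∈ right ij.2)
  symm := ⟨fun _ _ ⟨h1, h2, h3, h4, h5⟩ => ⟨h1.symm, h3, h2, h5, h4⟩⟩
  loopless := ⟨fun _ h => h.1 rfl⟩

/-- Needed because a stream must not repeat an edge, whatever the bits are. -/
lemma disjoint_bitGraph_queryGraph (x : Fin p × Fin p → Bool) (ij : Fin p × Fin p) :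
    Disjoint (bitGraph x : SimpleGraph (Vert p b q)) (queryGraph ij) := by
  rw [← SimpleGraph.disjoint_edgeSet, Set.disjoint_left]
  intro e
  induction e with | h u v => ?_
  simp only [SimpleGraph.mem_edgeSet]
  rintro ⟨i, j, -, h⟩ ⟨-, hu, hv, h1, h2⟩
  revert hu hv h1 h2
  rcases h with ⟨hu, hv⟩ | ⟨hv, hu⟩ <;>
  · simp only [left, right, Finset.mem_image, Finset.mem_univ, true_and] at hu hv
    obtain ⟨t, rfl⟩ := hu
    obtain ⟨t', rfl⟩ := hv
    simp +contextual [core, left, right, hub]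

/-- The gadget for the bits `x` and the query `ij`. -/
def gadget (x : Fin p × Fin p → Bool) (ij : Fin p × Fin p) : SimpleGraph (Vert p b q) :=
  bitGraph x ⊔ queryGraph ij

variable {x : Fin p × Fin p → Bool} {ij : Fin p × Fin p}

/-- A vertex outside the core only meets vertices of the opposite side. -/
lemma ncard_adj_le_of_notMem_core {v : Vert p b q} (hv : v ∉ core ij) (S : Set (Vert p b q)) :
    {u ∈ S | (gadget x ij).Adj v u}.ncard ≤ p * b := by
  have hq : ∀ u, (gadget x ij).Adj v u → (bitGraph x).Adj v u := by
    rintro u (h | h)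
    · exact h
    · exact absurd h.2.1 hv
  rcases v with v | v | v
  · refine ncard_le_of_subset_finset
      (B := Finset.univ.image fun w : Fin p × Fin b => Sum.inr (Sum.inl w)) ?_
      (Finset.card_image_le.trans (by simp))
    rintro u ⟨-, hu⟩
    obtain ⟨i, j, -, h⟩ := hq u hu
    rcases h with ⟨-, h⟩ | ⟨-, h⟩
    · simp only [right, Finset.mem_image, Finset.mem_univ, true_and] at h
      obtain ⟨t, rfl⟩ := h
      simp
    · simp [right] at h
  · refine ncard_le_of_subset_finset
      (B := Finset.univ.image fun w : Fin p × Fin b => Sum.inl w) ?_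
      (Finset.card_image_le.trans (by simp))
    rintro u ⟨-, hu⟩
    obtain ⟨i, j, -, h⟩ := hq u hu
    rcases h with ⟨h, -⟩ | ⟨h, -⟩
    · simp [left] at h
    · simp only [left, Finset.mem_image, Finset.mem_univ, true_and] at h
      obtain ⟨t, rfl⟩ := h
      simp
  · exact absurd (by simp [core, hub]) hv

lemma isClique_core (hx : x ij = true) :
    (gadget x ij).IsClique ((core ij : Finset (Vert p b q)) : Set (Vert p b q)) := by
  intro u hu v hv hne
  by_cases h : (u ∈ left ij.1 ∧ v ∈ right ij.2) ∨ (v ∈ left ij.1 ∧ u ∈ right ij.2)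
  · exact Or.inl ⟨ij.1, ij.2, hx, h⟩
  · rw [not_or] at h
    exact Or.inr ⟨hne, hu, hv, h.1, h.2⟩

lemma degeneracy_gadget_of_true (hpq : p * b ≤ q) (hb : 1 ≤ b) (hx : x ij = true) :
    degeneracy (gadget x ij : SimpleGraph (Vert p b q)) = q + 2 * b - 1 := by
  refine degeneracy_eq ?_ (isClique_core hx) (by rw [card_core]; omega)
  intro S hS
  by_cases h : ∃ v ∈ S, v ∉ core ij
  · obtain ⟨v, hv, hvc⟩ := h
    exact ⟨v, hv, (ncard_adj_le_of_notMem_core hvc S).trans (by omega)⟩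
  · push Not at h
    obtain ⟨v, hv⟩ := hS
    refine ⟨v, hv, ncard_lt_of_subset_erase (h v hv) ?_ (by rw [card_core]; omega)⟩
    rintro u ⟨hu, huv⟩
    exact Finset.mem_coe.2 (Finset.mem_erase.2 ⟨huv.ne', h u hu⟩)

/-- If the bit is not set then there are no edges between the two selected blocks. -/
lemma not_adj_of_false (hx : x ij = false) {u v : Vert p b q} (hu : u ∈ left ij.1)
    (hv : v ∈ right ij.2) : ¬ (gadget x ij).Adj u v := by
  rintro (⟨i, j, hij, h⟩ | h)
  · simp only [left, right, Finset.mem_image, Finset.mem_univ, true_and] at hu hv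
    obtain ⟨t, rfl⟩ := hu
    obtain ⟨t', rfl⟩ := hv
    simp only [left, right, Finset.mem_image, Finset.mem_univ, true_and, Sum.inl.injEq,
      Sum.inr.injEq, Prod.mk.injEq, reduceCtorEq, exists_false, and_self, or_false] at h
    obtain ⟨⟨_, rfl, _⟩, ⟨_, rfl, _⟩⟩ := h
    simp [hx] at hij
  · exact h.2.2.2.1 ⟨hu, hv⟩

lemma degeneracy_gadget_of_false (hpq : p * b ≤ q) (hb : 1 ≤ b) (hx : x ij = false) :
    degeneracy (gadget x ij : SimpleGraph (Vert p b q)) = q + b - 1 := by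
  have hL : (left ij.1 ∪ hub : Finset (Vert p b q)).card = b + q := by
    rw [Finset.card_union_of_disjoint (disjoint_left_hub _), card_left, card_hub]
  have hR : (right ij.2 ∪ hub : Finset (Vert p b q)).card = b + q := by
    rw [Finset.card_union_of_disjoint (disjoint_right_hub _), card_right, card_hub]
  refine degeneracy_eq (K := left ij.1 ∪ hub) ?_ ?_ (by omega)
  · intro S hS
    by_cases h : ∃ v ∈ S, v ∉ core ij
    · obtain ⟨v, hv, hvc⟩ := h
      exact ⟨v, hv, (ncard_adj_le_of_notMem_core hvc S).trans (by omega)⟩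
    push Not at h
    -- A vertex of the right block sees only its own block and the hub; without such a vertex, `S`
    -- lies in the left block and the hub. Either set has `b + q` vertices.
    by_cases h' : ∃ v ∈ S, v ∈ right ij.2
    · obtain ⟨v, hv, hvR⟩ := h'
      refine ⟨v, hv, ncard_lt_of_subset_erase (B := right ij.2 ∪ hub)
        (Finset.mem_union_left _ hvR) ?_ (by omega)⟩
      rintro u ⟨hu, huv⟩
      refine Finset.mem_coe.2 (Finset.mem_erase.2 ⟨huv.ne', ?_⟩)
      have := h u hu
      rw [core, Finset.mem_union] at this
      exact this.resolve_left fun huL => not_adj_of_false hx huL hvR huv.symm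
    · push Not at h'
      have hLS : ∀ v ∈ S, v ∈ (left ij.1 ∪ hub : Finset (Vert p b q)) := by
        intro v hv
        have h1 := h v hv
        have h2 := h' v hv
        simp only [core, Finset.mem_union] at h1 ⊢
        tauto
      obtain ⟨v, hv⟩ := hS
      refine ⟨v, hv, ncard_lt_of_subset_erase (hLS v hv) ?_ (by omega)⟩
      rintro u ⟨hu, huv⟩
      exact Finset.mem_coe.2 (Finset.mem_erase.2 ⟨huv.ne', hLS u hu⟩)
  · intro u hu v hv hne
    have hnR : ∀ w ∈ (left ij.1 ∪ hub : Finset (Vert p b q)), w ∉ right ij.2 := by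
      intro w hw hwR
      rcases Finset.mem_union.1 hw with hw | hw
      · exact Finset.disjoint_left.1 (disjoint_left_right _ _) hw hwR
      · exact Finset.disjoint_left.1 (disjoint_right_hub _) hwR hw
    have hc : ∀ w ∈ (left ij.1 ∪ hub : Finset (Vert p b q)), w ∈ core ij := by
      intro w hw
      simp only [core, Finset.mem_union] at hw ⊢
      tauto
    exact Or.inr ⟨hne, hc u hu, hc v hv, fun h => hnR v hv h.2, fun h => hnR u hu h.2⟩

/-- Decoding a colouring: the bit is set iff the two selected blocks have no colour in common,
provided that there are fewer colours than vertices in the core. -/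
lemma coloring_decodes {col : Vert p b q → ℕ} {c : ℕ}
    (hcol : ∀ u v, (gadget x ij).Adj u v → col u ≠ col v)
    (hcard : (Finset.univ.image col).card ≤ c) (hc : x ij = false → c < 2 * b + q) :
    x ij = true ↔ ∀ u ∈ left ij.1, ∀ v ∈ right ij.2, col u ≠ col v := by
  constructor
  · intro hx u hu v hv
    refine hcol u v (isClique_core hx ?_ ?_ ?_)
    · simp [core, hu]
    · simp [core, hv]
    · rintro rfl
      exact Finset.disjoint_left.1 (disjoint_left_right _ _) hu hv
  · intro h
    by_contra hx
    rw [Bool.not_eq_true] at hx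
    have hlt : (Finset.univ.image col).card < (core ij : Finset (Vert p b q)).card := by
      rw [card_core]; exact hcard.trans_lt (hc hx)
    obtain ⟨u, hu, v, hv, hne, heq⟩ := Finset.exists_ne_map_eq_of_card_lt_of_maps_to hlt
      (fun u _ => Finset.mem_image_of_mem col (Finset.mem_univ u))
    refine hcol u v (Or.inr ⟨hne, hu, hv, ?_, ?_⟩) heq
    · exact fun h' => h u h'.1 v h'.2 heq
    · exact fun h' => h v h'.1 u h'.2 heq.symm

end IndexGadget

/-! ### From the gadget to streams on `Fin n`. -/

lemma isEdgeStream_append {n : ℕ} {H H' : SimpleGraph (Fin n)} (h : Disjoint H H')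
    [Fintype H.edgeSet] [Fintype H'.edgeSet] :
    IsEdgeStream (H ⊔ H') (H.edgeFinset.toList ++ H'.edgeFinset.toList) := by
  refine ⟨?_, fun e => by simp⟩
  rw [List.nodup_append']
  refine ⟨Finset.nodup_toList _, Finset.nodup_toList _, fun e he he' => ?_⟩
  rw [← SimpleGraph.disjoint_edgeSet, Set.disjoint_left] at h
  exact h (by simpa using he) (by simpa using he')

namespace IndexGadget

variable {p b q : ℕ}

/-- A task whose good outputs on the gadgets reveal the queried bit needs `Ω(p ^ 2)` space. -/
lemma sq_le_of_solves {n s : ℕ} {Out : Type} {A : RandStreamAlg n s Out}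
    {Good : SimpleGraph (Fin n) → Out → Prop} (hA : A.Solves Good) (e : Fin n ≃ Vert p b q)
    (dec : Fin p × Fin p → Out → Prop)
    (hdec : ∀ x ij o, Good ((gadget x ij).comap e) o → (x ij = true ↔ dec ij o)) :
    p ^ 2 ≤ 15 * s := by
  classical
  have := card_le_of_solves (ι := Fin p × Fin p) hA (fun x ij => (gadget x ij).comap e)
    (fun x => ((bitGraph x).comap e).edgeFinset.toList)
    (fun ij => ((queryGraph ij).comap e).edgeFinset.toList)
    (fun x ij => ?_) (fun ij o => decide (dec ij o)) (fun x ij o h => ?_)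
  · simpa [sq] using this
  · have hsup : (gadget x ij).comap e = (bitGraph x).comap e ⊔ (queryGraph ij).comap e := rfl
    rw [hsup]
    refine isEdgeStream_append ?_
    rw [← SimpleGraph.disjoint_edgeSet, Set.disjoint_left]
    intro a
    induction a with | h u v => ?_
    have h := disjoint_bitGraph_queryGraph (b := b) (q := q) x ij
    rw [← SimpleGraph.disjoint_edgeSet, Set.disjoint_left] at h
    exact @h s(e u, e v)
  · rw [Bool.eq_iff_iff, decide_eq_true_eq]
    exact (hdec x ij o h).symm

lemma degeneracy_comap {n : ℕ} (e : Fin n ≃ Vert p b q) (G : SimpleGraph (Vert p b q)) :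
    degeneracy (G.comap e) = degeneracy G :=
  degeneracy_congr (SimpleGraph.Iso.comap e G)

end IndexGadget

open IndexGadget

/-- The equivalence that realizes the gadget on `Fin n`. -/
lemma nonempty_equiv_vert {n p b : ℕ} (h : 2 * (p * b) ≤ n) :
    Nonempty (Fin n ≃ Vert p b (n - 2 * (p * b))) := by
  refine Fintype.card_eq.1 ?_
  simp only [Fintype.card_fin, Fintype.card_sum, Fintype.card_prod]
  omega

lemma sq_le_of_coloringInSpace {n s p b : ℕ} {lam : ℕ → ℕ} (hb : 1 ≤ b) (h : 3 * (p * b) ≤ n)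
    (hlam : lam (n - 2 * (p * b) + b - 1) ≤ b) (hs : ColoringInSpace n s lam) :
    p ^ 2 ≤ 15 * s := by
  obtain ⟨e⟩ := nonempty_equiv_vert (n := n) (p := p) (b := b) (by omega)
  obtain ⟨A, hA⟩ := hs
  refine sq_le_of_solves hA e
    (fun ij col => ∀ u ∈ left ij.1, ∀ v ∈ right ij.2, col (e.symm u) ≠ col (e.symm v)) ?_
  rintro x ij col ⟨hcol, hcard⟩
  rw [degeneracy_comap] at hcard
  refine coloring_decodes (col := fun u => col (e.symm u)) ?_ (le_trans ?_ hcard) ?_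
  · intro u v huv
    exact hcol _ _ (by simpa using huv)
  · refine Finset.card_le_card fun c hc => ?_
    simp only [Finset.mem_image, Finset.mem_univ, true_and] at hc ⊢
    obtain ⟨u, hu⟩ := hc
    exact ⟨_, hu⟩
  · intro hx
    rw [degeneracy_gadget_of_false (by omega) hb hx]
    omega

lemma sq_le_of_estimationInSpace {n s p b : ℕ} {lam : ℕ → ℕ} (hb : 1 ≤ b) (h : 3 * (p * b) ≤ n)
    (hlam : lam (n - 2 * (p * b) + b - 1) + lam (n - 2 * (p * b) + 2 * b - 1) < b)
    (hs : EstimationInSpace n s lam) : p ^ 2 ≤ 15 * s := by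
  obtain ⟨e⟩ := nonempty_equiv_vert (n := n) (p := p) (b := b) (by omega)
  obtain ⟨A, hA⟩ := hs
  set q := n - 2 * (p * b) with hq
  refine sq_le_of_solves hA e
    -- The threshold is the largest estimate that is correct for bit 0; the gap `b` exceeds the two
    -- slacks together, so correct estimates for bit 1 lie above it.
    (fun _ est => ((q + b - 1 : ℕ) : ℝ) + (lam (q + b - 1) : ℝ) < est) ?_
  intro x ij est hest
  have hlam' : (lam (q + b - 1) : ℝ) + lam (q + 2 * b - 1) < b := by exact_mod_cast hlam
  have hκ : ((q + 2 * b - 1 : ℕ) : ℝ) = ((q + b - 1 : ℕ) : ℝ) + b := by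
    rw [← Nat.cast_add]; congr 1; omega
  rw [degeneracy_comap, abs_le] at hest
  cases hx : x ij
  · rw [degeneracy_gadget_of_false (by omega) hb hx] at hest
    simp only [Bool.false_eq_true, false_iff, not_lt]
    linarith [hest.2]
  · rw [degeneracy_gadget_of_true (by omega) hb hx, hκ] at hest
    simp only [true_iff]
    linarith [hest.1]

lemma sq_le_of_coloring_or_estimation {n s p b : ℕ} {lam : ℕ → ℕ} (h : 3 * (p * b) ≤ n)
    (hlam : lam (n - 2 * (p * b) + b - 1) + lam (n - 2 * (p * b) + 2 * b - 1) < b)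
    (hs : ColoringInSpace n s lam ∨ EstimationInSpace n s lam) : p ^ 2 ≤ 15 * s :=
  hs.elim (sq_le_of_coloringInSpace (by omega) h (by omega))
    (sq_le_of_estimationInSpace (by omega) h hlam)

/-! ### Choice of parameters for both bounds. -/

lemma space_lower_bound_const {lam n s : ℕ} (hlam : 1 ≤ lam) (hn : 9 * lam ≤ n)
    (hs : ColoringInSpace n s (fun _ => lam) ∨ EstimationInSpace n s (fun _ => lam)) :
    (1 / 4860 : ℝ) * ((n : ℝ) ^ 2 / (lam : ℝ) ^ 2) ≤ s := by
  have h1 : 9 * lam * (n / (9 * lam)) ≤ n := Nat.mul_div_le n (9 * lam)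
  have h2 : 1 ≤ n / (9 * lam) := (Nat.one_le_div_iff (by omega)).2 hn
  have h3 : n < 9 * lam * (n / (9 * lam)) + 9 * lam := by
    have := Nat.lt_mul_div_succ n (show 0 < 9 * lam by omega)
    linarith
  set p := n / (9 * lam) with hp
  -- The least `b` exceeding twice the slack; `3 * b ≤ 9 * lam` makes the gadget fit. Rounding in
  -- `p` costs a factor of at most 2, and `4860 = 15 * 18 ^ 2`.
  have hsq := sq_le_of_coloring_or_estimation (p := p) (b := 2 * lam + 1)
    (by nlinarith) (by omega) hs
  have h4 : n ≤ 18 * lam * p := by nlinarith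
  have h5 : (n : ℝ) ≤ 18 * lam * p := by exact_mod_cast h4
  have hl : (0 : ℝ) < lam := by exact_mod_cast hlam
  have h6 : (n : ℝ) / lam ≤ 18 * p := by
    rw [div_le_iff₀ hl]; linarith
  have h7 : ((n : ℝ) / lam) ^ 2 ≤ (18 * p) ^ 2 := by gcongr
  have h8 : (p : ℝ) ^ 2 ≤ 15 * s := by exact_mod_cast hsq
  rw [← div_pow]
  linarith

/-- If the slack is `O(κ ^ δ)`, `δ ∈ (0, 1 / 2)`, then the space is `Ω(n ^ (2 - 2 * δ))`. -/
lemma exists_space_lower_bound {δ : ℝ} (hδ0 : 0 < δ) (hδ : δ < 1 / 2) {lam : ℕ → ℕ}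
    (hlam : (fun k => (lam k : ℝ)) =O[atTop] fun k : ℕ => (k : ℝ) ^ δ) :
    ∃ B : ℝ, 0 < B ∧ ∀ᶠ n : ℕ in atTop, ∀ s : ℕ,
      ColoringInSpace n s lam ∨ EstimationInSpace n s lam → (n : ℝ) ^ (2 - 2 * δ) ≤ B * s := by
  obtain ⟨A, hA0, hA⟩ := hlam.exists_pos
  obtain ⟨K, hK⟩ := eventually_atTop.1 hA.bound
  set b : ℕ → ℕ := fun n => 2 * ⌊A * (n : ℝ) ^ δ⌋₊ + 1 with hb
  have hbup : ∀ n : ℕ, 1 ≤ n → (b n : ℝ) ≤ (2 * A + 1) * (n : ℝ) ^ δ := by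
    intro n hn
    have h1 : (1 : ℝ) ≤ (n : ℝ) ^ δ := Real.one_le_rpow (by exact_mod_cast hn) hδ0.le
    have h2 : (⌊A * (n : ℝ) ^ δ⌋₊ : ℝ) ≤ A * (n : ℝ) ^ δ := Nat.floor_le (by positivity)
    simp only [hb]
    push_cast
    linarith
  have hsmall : ∀ᶠ n : ℕ in atTop, 3 * b n ≤ n := by
    have h1 : Tendsto (fun n : ℕ => (n : ℝ) ^ (1 - δ)) atTop atTop :=
      (tendsto_rpow_atTop (by linarith)).comp tendsto_natCast_atTop_atTop
    filter_upwards [h1.eventually_ge_atTop (3 * (2 * A + 1)), eventually_ge_atTop 1] with n hn hn1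
    have hn0 : (0 : ℝ) < n := by exact_mod_cast hn1
    rw [Real.rpow_sub hn0, Real.rpow_one, le_div_iff₀ (by positivity)] at hn
    have h2 := hbup n hn1
    have h3 : (3 * b n : ℝ) ≤ n := by linarith
    exact_mod_cast h3
  refine ⟨15 * (6 * (2 * A + 1)) ^ 2, by positivity, ?_⟩
  filter_upwards [hsmall, eventually_ge_atTop 1, eventually_ge_atTop (3 * K)] with n hn hn1 hnK s hs
  have hb1 : 1 ≤ b n := by simp [hb]
  have h1 : 3 * b n * (n / (3 * b n)) ≤ n := Nat.mul_div_le _ _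
  have h2 : 1 ≤ n / (3 * b n) := (Nat.one_le_div_iff (by omega)).2 hn
  have h3 : n < 3 * b n * (n / (3 * b n)) + 3 * b n := by
    have := Nat.lt_mul_div_succ n (show 0 < 3 * b n by omega)
    linarith
  set p := n / (3 * b n) with hp
  have hpb : 3 * (p * b n) ≤ n := by linarith
  have hpb1 : b n ≤ p * b n := Nat.le_mul_of_pos_left _ h2
  -- Both gadget degeneracies lie between `n / 3 - 1` and `n`: the hub takes at least a third of the
  -- vertices. So the asymptotic bound on the slack applies to them once `n ≥ 3 * K`.
  have hlamle : ∀ k, K ≤ k → k ≤ n → lam k ≤ ⌊A * (n : ℝ) ^ δ⌋₊ := by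
    intro k hk hkn
    refine Nat.le_floor ?_
    have := hK k hk
    rw [Real.norm_of_nonneg (by positivity), Real.norm_of_nonneg (by positivity)] at this
    exact this.trans (by gcongr)
  have hsq := sq_le_of_coloring_or_estimation (p := p) (b := b n) hpb (by
    have h4 := hlamle (n - 2 * (p * b n) + b n - 1) (by omega) (by omega)
    have h5 := hlamle (n - 2 * (p * b n) + 2 * b n - 1) (by omega) (by omega)
    have h6 : b n = 2 * ⌊A * (n : ℝ) ^ δ⌋₊ + 1 := rfl
    omega) hs
  have h4 : (n : ℝ) ≤ 6 * (2 * A + 1) * (n : ℝ) ^ δ * p := by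
    have h5 : n ≤ 6 * b n * p := by nlinarith
    have h6 : (n : ℝ) ≤ 6 * b n * p := by exact_mod_cast h5
    refine h6.trans ?_
    have := mul_le_mul_of_nonneg_right (hbup n hn1) (show (0 : ℝ) ≤ 6 * p by positivity)
    linarith
  have hn0 : (0 : ℝ) < n := by exact_mod_cast hn1
  have h5 : (n : ℝ) ^ (1 - δ) ≤ 6 * (2 * A + 1) * p := by
    rw [Real.rpow_sub hn0, Real.rpow_one, div_le_iff₀ (by positivity)]
    linarith
  have h6 : (n : ℝ) ^ (2 - 2 * δ) = ((n : ℝ) ^ (1 - δ)) ^ 2 := by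
    rw [← Real.rpow_natCast, ← Real.rpow_mul hn0.le]
    congr 1; push_cast; ring
  have h7 : (p : ℝ) ^ 2 ≤ 15 * s := by exact_mod_cast hsq
  calc (n : ℝ) ^ (2 - 2 * δ) ≤ (6 * (2 * A + 1) * p) ^ 2 := by rw [h6]; gcongr
    _ = (6 * (2 * A + 1)) ^ 2 * (p : ℝ) ^ 2 := by ring
    _ ≤ (6 * (2 * A + 1)) ^ 2 * (15 * s) := by gcongr
    _ = _ := by ring

lemma IsSemiStreaming.isLittleO {s : ℕ → ℕ} (hs : IsSemiStreaming s) {a : ℝ} (ha : 1 < a) :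
    (fun n => (s n : ℝ)) =o[atTop] fun n : ℕ => (n : ℝ) ^ a := by
  obtain ⟨k, hk⟩ := hs
  refine hk.trans_isLittleO ?_
  have h1 : (fun n : ℕ => Real.log n ^ k) =o[atTop] fun n : ℕ => (n : ℝ) ^ (a - 1) := by
    have := (isLittleO_log_rpow_rpow_atTop (s := a - 1) (k : ℝ) (by linarith)).comp_tendsto
      (tendsto_natCast_atTop_atTop (R := ℝ))
    simpa [Function.comp_def] using this
  refine ((isBigO_refl (fun n : ℕ => (n : ℝ)) atTop).mul_isLittleO h1).congr'
    EventuallyEq.rfl ?_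
  filter_upwards [eventually_ge_atTop 1] with n hn
  have hn0 : (0 : ℝ) < n := by exact_mod_cast hn
  rw [← Real.rpow_one_add' hn0.le (by linarith)]
  congr 1; ring

theorem mainTheorem4 :
    (∃ c : ℝ, 0 < c ∧ ∃ C : ℕ, ∀ lam : ℕ, 1 ≤ lam → ∀ n : ℕ, C * lam ≤ n → ∀ s : ℕ,
      (ColoringInSpace n s (fun _ => lam) → c * ((n : ℝ) ^ 2 / (lam : ℝ) ^ 2) ≤ (s : ℝ)) ∧
      (EstimationInSpace n s (fun _ => lam) → c * ((n : ℝ) ^ 2 / (lam : ℝ) ^ 2) ≤ (s : ℝ))) ∧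
    (∀ γ : ℝ, 0 < γ → ∀ lam : ℕ → ℕ, (∀ k, 1 ≤ lam k) →
      ((fun k => (lam k : ℝ)) =O[atTop] fun k : ℕ => (k : ℝ) ^ (1 / 2 - γ)) →
      ∀ s : ℕ → ℕ, IsSemiStreaming s →
        ∀ᶠ n : ℕ in atTop,
          ¬ ColoringInSpace n (s n) lam ∧ ¬ EstimationInSpace n (s n) lam) := by
  refine ⟨⟨1 / 4860, by norm_num, 9, fun lam hlam n hn s =>
    ⟨fun h => space_lower_bound_const hlam hn (.inl h),
      fun h => space_lower_bound_const hlam hn (.inr h)⟩⟩, ?_⟩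
  intro γ hγ lam _ hO s hs
  -- The exponent `1 / 2 - γ` may be negative; raising it to a positive one below `1 / 2` makes the
  -- bound on the slack monotone in the degeneracy.
  set δ : ℝ := max (1 / 2 - γ) (1 / 4) with hδ
  have hδ0 : 0 < δ := lt_max_of_lt_right (by norm_num)
  have hδ1 : δ < 1 / 2 := max_lt (by linarith) (by norm_num)
  have hO' : (fun k => (lam k : ℝ)) =O[atTop] fun k : ℕ => (k : ℝ) ^ δ := by
    refine hO.trans (IsBigO.of_bound 1 ?_)
    filter_upwards [eventually_ge_atTop 1] with k hk
    rw [Real.norm_of_nonneg (by positivity), Real.norm_of_nonneg (by positivity), one_mul]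
    exact Real.rpow_le_rpow_of_exponent_le (by exact_mod_cast hk) (le_max_left _ _)
  obtain ⟨B, hB, hlow⟩ := exists_space_lower_bound hδ0 hδ1 hO'
  -- With this constant, `B * s n` is at most half of `n ^ (2 - 2 * δ)`, against the lower bound.
  have hc : 0 < 1 / (2 * B) := by positivity
  filter_upwards [hlow, (hs.isLittleO (a := 2 - 2 * δ) (by linarith)).bound hc,
    eventually_ge_atTop 1] with n hn hsn hn1
  rw [← not_or]
  intro h
  have h1 := hn _ h
  have hpos : (0 : ℝ) < (n : ℝ) ^ (2 - 2 * δ) :=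
    Real.rpow_pos_of_pos (by exact_mod_cast hn1) _
  rw [Real.norm_of_nonneg (by positivity), Real.norm_of_nonneg hpos.le, div_mul_eq_mul_div,
    one_mul, le_div_iff₀ (by positivity)] at hsn
  linarith
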